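/- Consider a one-to-one matching market with a finite set $F$ of firms and a finite set $W$ of workers, $|F|=|W|=n$. Each firm $f$ has a strict (linear) preference $\succ_f$ over $W\cup\{f\}$ and each worker $w$ a strict (linear) preference $\succ_w$ over $F\cup\{w\}$ (being matched to oneself means being single). All pairs are mutually acceptable: $w\succ_f f$ and $f\succ_w w$ for all $f\in F$, $w\in W$. A matching $\mu$ assigns to each firm a worker or herself and to each worker a firm or himself, with $\mu(f)=w$ if and only if $\mu(w)=f$. A pair $(f,w)$ with $\mu(f)\ne w$ is a blocking pair of $\mu$ if $w\succ_f\mu(f)$ and $f\succ_w\mu(w)$; it is a best blocking pair if, moreover, for at least one of its two members, that agent prefers the partner in this pair to every other partner with whom she or he could form a blocking pair of $\mu$. A matching is stable if it has no blocking pairs, and unstable otherwise. Satisfying a blocking pair $(f,w)$ of $\lambda$ produces the matching in which $f$ and $w$ are matched to each other, their partners at $\lambda$ (if any) are unmatched, and all other agents are matched as in $\lambda$. A finite sequence of (best) blocking pairs leads from $\lambda$ to $\mu$ if $\mu$ results from $\lambda$ by successively satisfying finitely many pairs, each a (best) blocking pair of the current matching. A matching is almost stable if satisfying some single blocking pair of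 it produces a stable matching. Sets $\bar F\subsetneq F$ and $\bar W\subsetneq W$ of equal size form a fragment if the market restricted to $\bar F\cup\bar W$ (with inherited preferences) has a stable matching $\bar\mu$ such that $\bar\mu(\bar f)\succ_{\bar f} w$ for all $\bar f\in\bar F$, $w\in W\setminus\bar W$, and $\bar\mu(\bar w)\succ_{\bar w} f$ for all $\bar w\in\bar W$, $f\in F\setminus\bar F$. The fragment is trivial if all stable matchings of the original market agree on how they match the agents in $\bar F\cup\bar W$, and non-trivial otherwise. Theorem. The following three statements are equivalent: (i) for any unstable matching $\lambda$ and any stable matching $\mu$, there is a finite sequence of blocking pairs that leads from $\lambda$ to $\mu$; (ii) for any almost stable matching $\lambda$ and any stable matching $\mu$, there is a finite sequence of blocking pairs that leads from $\lambda$ to $\mu$; (iii) there are no non-trivial fragments. The same equivalence holds when "blocking pairs" is replaced by "best blocking pairs" in the sequences of both (i) and (ii) (the definition of almost stable being unchanged). -/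

import Mathlib

/-- A two-sided one-to-one matching market with firms `F` and workers `W`. An outcome for a firm is
an element of `Option W`, where `none` stands for staying single; similarly for a worker.
`firmPref f a b` says that firm `f` strictly prefers `a` to `b`. All preferences are strict
linear rankings of the potential partners and being single. -/
structure Market (F : Type*) (W : Type*) where
  firmPref : F → Option W → Option W → Prop
  workerPref : W → Option F → Option F → Prop
  firmPref_order : ∀ f, IsStrictTotalOrder (Option W) (firmPref f)
  workerPref_order : ∀ w, IsStrictTotalOrder (Option F) (workerPref w)

/-- A matching: a partial bijection between firms and workers. For `μ : Matching F W`, the partner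
of the firm `f` is `μ f`, the partner of the worker `w` is `μ.symm w`, and `none` means being
unmatched. -/
abbrev Matching (F : Type*) (W : Type*) := F ≃. W

namespace Market

/-- Every firm and every worker find each other acceptable, that is, better than being single. -/
def AllAcceptable {F W : Type*} (M : Market F W) : Prop :=
  ∀ (f : F) (w : W), M.firmPref f (some w) none ∧ M.workerPref w (some f) none

/-- `(f, w)` is a blocking pair of `μ`. -/
def Blocking {F W : Type*} (M : Market F W) (μ : Matching F W) (f : F) (w : W) : Prop :=
  μ f ≠ some w ∧ M.firmPref f (some w) (μ f) ∧ M.workerPref w (some f) (μ.symm w)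

/-- A matching is stable if it has no blocking pairs. (All markets considered have only mutually
acceptable pairs, so no agent would rather be single than keep a partner.) -/
def Stable {F W : Type*} (M : Market F W) (μ : Matching F W) : Prop :=
  ∀ (f : F) (w : W), ¬ M.Blocking μ f w

/-- The blocking pair `(f, w)` is the best blocking pair for the firm `f`. -/
def BestForFirm {F W : Type*} (M : Market F W) (μ : Matching F W) (f : F) (w : W) : Prop :=
  M.Blocking μ f w ∧ ∀ w', M.Blocking μ f w' → w' ≠ w → M.firmPref f (some w) (some w')

/-- The blocking pair `(f, w)` is the best blocking pair for the worker `w`. -/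
def BestForWorker {F W : Type*} (M : Market F W) (μ : Matching F W) (f : F) (w : W) : Prop :=
  M.Blocking μ f w ∧ ∀ f', M.Blocking μ f' w → f' ≠ f → M.workerPref w (some f) (some f')

/-- `(f, w)` is a best blocking pair: it is the best blocking pair for one of its two members. -/
def BestBlocking {F W : Type*} (M : Market F W) (μ : Matching F W) (f : F) (w : W) : Prop :=
  M.BestForFirm μ f w ∨ M.BestForWorker μ f w

end Market

/-- `μ` arises from `l` by matching `f` with `w`, leaving their partners at `l` (if any) unmatched,
and keeping the matches of all other agents. -/
structure Matching.Satisfying {F W : Type*} (l : Matching F W) (f : F) (w : W)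
    (μ : Matching F W) : Prop where
  matched : μ f = some w
  firm_divorced : ∀ f', l.symm w = some f' → μ f' = none
  worker_divorced : ∀ w', l f = some w' → μ.symm w' = none
  firm_other : ∀ f', f' ≠ f → l.symm w ≠ some f' → μ f' = l f'
  worker_other : ∀ w', w' ≠ w → l f ≠ some w' → μ.symm w' = l.symm w'

namespace Market

/-- `μ` is obtained from `l` by satisfying a blocking pair of `l`. -/
def Step {F W : Type*} (M : Market F W) (l μ : Matching F W) : Prop :=
  ∃ f w, M.Blocking l f w ∧ Matching.Satisfying l f w μ

/-- `μ` is obtained from `l` by satisfying a best blocking pair of `l`. -/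
def BestStep {F W : Type*} (M : Market F W) (l μ : Matching F W) : Prop :=
  ∃ f w, M.BestBlocking l f w ∧ Matching.Satisfying l f w μ

/-- There is a finite sequence of blocking pairs that leads from `l` to `μ`. -/
def Reaches {F W : Type*} (M : Market F W) (l μ : Matching F W) : Prop :=
  Relation.ReflTransGen M.Step l μ

/-- There is a finite sequence of best blocking pairs that leads from `l` to `μ`. -/
def BestReaches {F W : Type*} (M : Market F W) (l μ : Matching F W) : Prop :=
  Relation.ReflTransGen M.BestStep l μ

/-- A matching is almost stable if it is one blocking pair away from a stable matching. -/
def AlmostStable {F W : Type*} (M : Market F W) (l : Matching F W) : Prop :=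
  ∃ μ, M.Stable μ ∧ M.Step l μ

/-- The submarket formed by the firms in `A` and the workers in `B`, with inherited preferences. -/
def restrict {F W : Type*} (M : Market F W) (A : Finset F) (B : Finset W) : Market A B where
  firmPref f a b := M.firmPref f (a.map Subtype.val) (b.map Subtype.val)
  workerPref w a b := M.workerPref w (a.map Subtype.val) (b.map Subtype.val)
  firmPref_order f :=
    haveI := M.firmPref_order f
    RelEmbedding.isStrictTotalOrder
      (⟨⟨Option.map Subtype.val, Option.map_injective Subtype.val_injective⟩, Iff.rfl⟩ :
        (fun a b : Option B => M.firmPref f (a.map Subtype.val) (b.map Subtype.val))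
          ↪r M.firmPref f)
  workerPref_order w :=
    haveI := M.workerPref_order w
    RelEmbedding.isStrictTotalOrder
      (⟨⟨Option.map Subtype.val, Option.map_injective Subtype.val_injective⟩, Iff.rfl⟩ :
        (fun a b : Option A => M.workerPref w (a.map Subtype.val) (b.map Subtype.val))
          ↪r M.workerPref w)

/-- `ν` induces the fragment `(A, B)`: it is stable in the submarket, and every agent inside
prefers her partner under `ν` to every agent outside. -/
def Induces {F W : Type*} (M : Market F W) (A : Finset F) (B : Finset W)
    (ν : Matching A B) : Prop :=
  (M.restrict A B).Stable ν ∧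
  (∀ (f : A) (w : W), w ∉ B → M.firmPref f ((ν f).map Subtype.val) (some w)) ∧
  (∀ (w : B) (f : F), f ∉ A → M.workerPref w ((ν.symm w).map Subtype.val) (some f))

/-- `(A, B)` is a fragment: proper subsets of firms and workers of equal size for which an
inducing matching exists. -/
def IsFragment {F W : Type*} [Fintype F] [Fintype W] (M : Market F W)
    (A : Finset F) (B : Finset W) : Prop :=
  A ⊂ Finset.univ ∧ B ⊂ Finset.univ ∧ A.card = B.card ∧ ∃ ν : Matching A B, M.Induces A B ν

/-- All stable matchings of the whole market match the agents of `(A, B)` in the same way. -/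
def StableAgreeOn {F W : Type*} (M : Market F W) (A : Finset F) (B : Finset W) : Prop :=
  ∀ μ μ' : Matching F W, M.Stable μ → M.Stable μ' →
    (∀ f ∈ A, μ f = μ' f) ∧ (∀ w ∈ B, μ.symm w = μ'.symm w)

/-- A fragment is non-trivial if the stable matchings do not all agree on it. -/
def IsNontrivialFragment {F W : Type*} [Fintype F] [Fintype W] (M : Market F W)
    (A : Finset F) (B : Finset W) : Prop :=
  M.IsFragment A B ∧ ¬ M.StableAgreeOn A B

end Market

/-! (i) implies (ii) because an almost stable matching is unstable. For (ii) implies (iii),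
fragments are absorbing: while the agents inside are matched as an inducing matching prescribes,
none of them is in a blocking pair (`Extends.step`). Some stable matching respects the fragment;
separating one of its pairs outside leaves an almost stable matching from which only matchings
respecting the fragment are reachable, so by (ii) all stable matchings agree on it.

For (iii) implies (i), best blocking pairs lead from anywhere to stability
(`exists_stable_bestReaches`), and the last matching before is almost stable. Stable matchings are
perfect here, so an almost stable one is a stable matching with one pair separated: a hole. The hole
can move from an envied pair to an envying one (`bestReaches_remove_of_envies`). The firms reachable
by envy from a firm `k`, with their partners, form a fragment unless they are all firms; without
non-trivial fragments the hole can therefore move to every firm whose stable partner varies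
(`reflTransGen_envies`). From such a hole, deferred acceptance by the workers yields a stable
matching better for the firms, bounded by any prescribed stable matching above
(`exists_stable_bestReaches_remove`). Climb in this way to the firms' join of the present and the
target matching, then exchange the two sides and descend to the target. -/

/-! ### Satisfying and separating a pair -/

namespace Matching

variable {F W : Type*}

open Classical in
/-- The matching that arises from `l` by satisfying the pair `(f, w)`. -/
noncomputable def satisfy (l : Matching F W) (f : F) (w : W) : Matching F W where
  toFun g := if g = f then some w else if l g = some w then none else l g
  invFun v := if v = w then some f else if l f = some v then none else l.symm v
  inv g v := by
    have h1 := l.eq_some_iff (a := g) (b := v)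
    have h2 := l.eq_some_iff (a := f) (b := v)
    change _ = some g ↔ _ = some v
    split_ifs <;> grind

open Classical in
theorem satisfy_apply (l : Matching F W) (f : F) (w : W) (g : F) :
    l.satisfy f w g = if g = f then some w else if l g = some w then none else l g := rfl

open Classical in
theorem satisfy_symm_apply (l : Matching F W) (f : F) (w : W) (v : W) :
    (l.satisfy f w).symm v = if v = w then some f else if l f = some v then none else l.symm v :=
  rfl

theorem satisfying_satisfy (l : Matching F W) (f : F) (w : W) (h : l f ≠ some w) :
    Satisfying l f w (l.satisfy f w) := by
  have h1 := fun g v => l.eq_some_iff (a := g) (b := v)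
  constructor <;> intros <;> simp only [satisfy_apply, satisfy_symm_apply] <;> grind

theorem Satisfying.symm {l μ : Matching F W} {f : F} {w : W} (h : Satisfying l f w μ) :
    Satisfying (F := W) (W := F) l.symm w f μ.symm :=
  ⟨μ.eq_some_iff.2 h.matched, h.worker_divorced, h.firm_divorced, h.worker_other, h.firm_other⟩

open Classical in
/-- The matching `μ` with the pair of the firm `f` separated. -/
noncomputable def remove (μ : Matching F W) (f : F) : Matching F W where
  toFun g := if g = f then none else μ g
  invFun v := if μ f = some v then none else μ.symm v
  inv g v := by
    have h1 := μ.eq_some_iff (a := g) (b := v)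
    have h2 := μ.eq_some_iff (a := f) (b := v)
    change _ = some g ↔ _ = some v
    split_ifs <;> grind

open Classical in
theorem remove_apply (μ : Matching F W) (f g : F) :
    μ.remove f g = if g = f then none else μ g := rfl

open Classical in
theorem remove_symm_apply (μ : Matching F W) (f : F) (v : W) :
    (μ.remove f).symm v = if μ f = some v then none else μ.symm v := rfl

theorem remove_symm {μ : Matching F W} {f : F} {w : W} (h : μ f = some w) :
    (μ.remove f).symm = Matching.remove (F := W) (W := F) μ.symm w := by
  refine PEquiv.ext fun v => ?_
  rw [remove_symm_apply, remove_apply, h]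
  by_cases hv : v = w <;> simp [hv, Ne.symm]

end Matching

/-! ### Exchange of sides, strict preferences and ranks -/

namespace Market

variable {F W : Type*} (M : Market F W)

/-- The market with the two sides exchanged. -/
def swap : Market W F := ⟨M.workerPref, M.firmPref, M.workerPref_order, M.firmPref_order⟩

variable {M}

theorem firmPref_trans {f : F} {a b c : Option W} (h : M.firmPref f a b) (h' : M.firmPref f b c) :
    M.firmPref f a c :=
  have := M.firmPref_order f
  _root_.trans h h'

theorem firmPref_irrefl (f : F) (a : Option W) : ¬ M.firmPref f a a :=
  have := M.firmPref_order f
  irrefl a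

theorem firmPref_asymm {f : F} {a b : Option W} (h : M.firmPref f a b) : ¬ M.firmPref f b a :=
  fun h' => firmPref_irrefl f a (firmPref_trans h h')

theorem firmPref_total (f : F) {a b : Option W} (h : a ≠ b) :
    M.firmPref f a b ∨ M.firmPref f b a := by
  have := M.firmPref_order f
  rcases trichotomous_of (M.firmPref f) a b with h' | h' | h'
  · exact .inl h'
  · exact absurd h' h
  · exact .inr h'

theorem workerPref_trans {w : W} {a b c : Option F} (h : M.workerPref w a b)
    (h' : M.workerPref w b c) : M.workerPref w a c := firmPref_trans (M := M.swap) h h'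

theorem workerPref_irrefl (w : W) (a : Option F) : ¬ M.workerPref w a a :=
  firmPref_irrefl (M := M.swap) w a

theorem workerPref_asymm {w : W} {a b : Option F} (h : M.workerPref w a b) :
    ¬ M.workerPref w b a := firmPref_asymm (M := M.swap) h

theorem workerPref_total (w : W) {a b : Option F} (h : a ≠ b) :
    M.workerPref w a b ∨ M.workerPref w b a := firmPref_total (M := M.swap) w h

theorem AllAcceptable.swap (h : M.AllAcceptable) : M.swap.AllAcceptable :=
  fun w f => ⟨(h f w).2, (h f w).1⟩

theorem Blocking.swap {μ : Matching F W} {f : F} {w : W} (h : M.Blocking μ f w) :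
    M.swap.Blocking μ.symm w f :=
  ⟨fun h' => h.1 (μ.eq_some_iff.1 h'), h.2.2, h.2.1⟩

theorem Stable.swap {μ : Matching F W} (h : M.Stable μ) : M.swap.Stable μ.symm :=
  fun w f hb => h f w (Blocking.swap (M := M.swap) hb)

theorem BestStep.swap {l μ : Matching F W} (h : M.BestStep l μ) :
    M.swap.BestStep l.symm μ.symm := by
  obtain ⟨f, w, h | h, hs⟩ := h
  · exact ⟨w, f, .inr ⟨h.1.swap, fun w' hb => h.2 w' (Blocking.swap (M := M.swap) hb)⟩, hs.symm⟩
  · exact ⟨w, f, .inl ⟨h.1.swap, fun f' hb => h.2 f' (Blocking.swap (M := M.swap) hb)⟩, hs.symm⟩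

theorem BestReaches.swap {l μ : Matching F W} (h : M.BestReaches l μ) :
    M.swap.BestReaches l.symm μ.symm :=
  Relation.ReflTransGen.lift (fun m : Matching F W => (m.symm : Matching W F))
    (fun _ _ => BestStep.swap) _ _ h

theorem BestStep.step {l μ : Matching F W} (h : M.BestStep l μ) : M.Step l μ := by
  obtain ⟨f, w, h | h, hs⟩ := h <;> exact ⟨f, w, h.1, hs⟩

theorem BestReaches.reaches {l μ : Matching F W} (h : M.BestReaches l μ) : M.Reaches l μ :=
  Relation.ReflTransGen.mono (fun _ _ => BestStep.step) _ _ h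

theorem BestForFirm.bestStep {l : Matching F W} {f : F} {w : W} (h : M.BestForFirm l f w) :
    M.BestStep l (l.satisfy f w) :=
  ⟨f, w, .inl h, l.satisfying_satisfy f w h.1.1⟩

theorem BestForWorker.bestStep {l : Matching F W} {f : F} {w : W} (h : M.BestForWorker l f w) :
    M.BestStep l (l.satisfy f w) :=
  ⟨f, w, .inr h, l.satisfying_satisfy f w h.1.1⟩

theorem Stable.workerPref_of_firmPref {μ : Matching F W} (h : M.Stable μ) {f : F} {w : W}
    (hp : M.firmPref f (some w) (μ f)) : M.workerPref w (μ.symm w) (some f) := by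
  have h1 : μ f ≠ some w := fun h' => firmPref_irrefl f (some w) (h' ▸ hp)
  have h2 : μ.symm w ≠ some f := fun h' => h1 (μ.eq_some_iff.1 h')
  rcases workerPref_total (M := M) w h2 with h3 | h3
  · exact h3
  · exact absurd ⟨h1, hp, h3⟩ (h f w)

theorem Stable.firmPref_of_workerPref {μ : Matching F W} (h : M.Stable μ) {f : F} {w : W}
    (hp : M.workerPref w (some f) (μ.symm w)) : M.firmPref f (μ f) (some w) :=
  h.swap.workerPref_of_firmPref hp

section Rank

variable (M) [Fintype W]

open Classical in
/-- The number of outcomes that the firm `f` prefers to `a`. -/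
noncomputable def firmRank (f : F) (a : Option W) : ℕ :=
  (Finset.univ.filter fun b => M.firmPref f b a).card

variable {M}

theorem firmRank_lt {f : F} {a b : Option W} (h : M.firmPref f a b) :
    M.firmRank f a < M.firmRank f b := by
  refine Finset.card_lt_card (Finset.ssubset_iff_of_subset ?_ |>.2 ⟨a, ?_, ?_⟩)
  · intro c
    simpa using fun hc => firmPref_trans hc h
  · simpa using h
  · simpa using firmPref_irrefl f a

theorem firmRank_le {f : F} {a b : Option W} (h : ¬ M.firmPref f b a) :
    M.firmRank f a ≤ M.firmRank f b := by
  by_cases hab : a = b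
  · rw [hab]
  · exact (firmRank_lt ((firmPref_total f hab).resolve_right h)).le

theorem exists_best_worker (f : F) {p : W → Prop} (hp : ∃ w, p w) :
    ∃ w, p w ∧ ∀ w', p w' → w' ≠ w → M.firmPref f (some w) (some w') := by
  obtain ⟨w, hw, hmin⟩ :=
    Set.exists_min_image {w | p w} (fun w => M.firmRank f (some w)) (Set.toFinite _) hp
  refine ⟨w, hw, fun w' hw' hne => ?_⟩
  rcases firmPref_total (M := M) f (a := some w) (b := some w') (by simpa using hne.symm) with h | h
  · exact h
  · exact absurd (firmRank_lt h) (not_lt.2 (hmin w' hw'))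

end Rank

theorem exists_best_firm [Fintype F] (w : W) {p : F → Prop} (hp : ∃ f, p f) :
    ∃ f, p f ∧ ∀ f', p f' → f' ≠ f → M.workerPref w (some f) (some f') :=
  exists_best_worker (M := M.swap) w hp

theorem exists_bestForFirm [Fintype W] {l : Matching F W} {f : F} (h : ∃ w, M.Blocking l f w) :
    ∃ w, M.BestForFirm l f w :=
  exists_best_worker f h

/-! ### Best blocking pairs lead to stability -/

/-- If no matched firm is in a blocking pair, letting single firms match with their best blocking
partners leads to a stable matching. -/
theorem exists_stable_of_matched_satisfied [Fintype F] [Fintype W] (l : Matching F W)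
    (h : ∀ f w, l f ≠ none → ¬ M.Blocking l f w) : ∃ μ, M.Stable μ ∧ M.BestReaches l μ := by
  classical
  -- Only single firms act, so no worker is ever abandoned: workers only improve and their total
  -- rank falls.
  induction hn : ∑ w, M.swap.firmRank w (l.symm w) using Nat.strong_induction_on generalizing l with
  | _ n ih =>
  subst hn
  by_cases hs : M.Stable l
  · exact ⟨l, hs, .refl⟩
  obtain ⟨f, w₀, hb⟩ : ∃ f w, M.Blocking l f w := by simpa [Stable] using hs
  obtain ⟨w, hw⟩ := exists_bestForFirm ⟨w₀, hb⟩
  have hf : l f = none := by by_contra hf; exact h f w₀ hf hb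
  have hsymm : ∀ v, (l.satisfy f w).symm v = if v = w then some f else l.symm v := by
    intro v; rw [Matching.satisfy_symm_apply]; simp [hf]
  suffices hstep : ∃ μ, M.Stable μ ∧ M.BestReaches (l.satisfy f w) μ by
    obtain ⟨μ, hμ, hr⟩ := hstep
    exact ⟨μ, hμ, .head hw.bestStep hr⟩
  refine ih _ (Finset.sum_lt_sum (s := Finset.univ)
      (f := fun v => M.swap.firmRank v ((l.satisfy f w).symm v)) ?_ ⟨w, Finset.mem_univ _, ?_⟩)
      (l.satisfy f w) ?_ rfl
  · intro v _
    rw [hsymm]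
    split_ifs with hv
    · subst hv; exact (firmRank_lt (M := M.swap) hw.1.2.2).le
    · rfl
  · simpa [hsymm] using firmRank_lt (M := M.swap) hw.1.2.2
  · intro g v hg hbl
    have happ := l.satisfy_apply f w g
    obtain ⟨h1, h2, h3⟩ := hbl
    rw [hsymm] at h3
    by_cases hgf : g = f
    · subst hgf
      rw [if_pos rfl] at happ
      rw [happ] at h1 h2
      rw [if_neg (fun e => h1 (by rw [e]))] at h3
      have h4 : M.Blocking l g v :=
        ⟨by simp [hf], firmPref_trans h2 hw.1.2.1, h3⟩
      exact firmPref_asymm h2 (hw.2 v h4 (fun e => h1 (by rw [e])))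
    · rw [if_neg hgf] at happ
      split_ifs at happ with hgw
      · exact hg happ
      · rw [happ] at h1 h2 hg
        split_ifs at h3 with hv
        · subst hv
          exact h g v hg ⟨h1, h2, workerPref_trans h3 hw.1.2.2⟩
        · exact h g v hg ⟨h1, h2, h3⟩

/-- Every matching leads to a stable matching by satisfying best blocking pairs. -/
theorem exists_stable_bestReaches [Fintype F] [Fintype W] (l : Matching F W) :
    ∃ μ, M.Stable μ ∧ M.BestReaches l μ := by
  classical
  -- A matched firm trades up, which lowers its term; a firm abandoned meanwhile drops to 0, so the
  -- sum still decreases.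
  induction hn : ∑ f, (if l f = none then 0 else 1 + M.firmRank f (l f))
    using Nat.strong_induction_on generalizing l with
  | _ n ih =>
  subst hn
  by_cases h : ∀ f w, l f ≠ none → ¬ M.Blocking l f w
  · exact exists_stable_of_matched_satisfied l h
  push Not at h
  obtain ⟨f, w₀, hf, hb⟩ := h
  obtain ⟨w, hw⟩ := exists_bestForFirm ⟨w₀, hb⟩
  suffices hstep : ∃ μ, M.Stable μ ∧ M.BestReaches (l.satisfy f w) μ by
    obtain ⟨μ, hμ, hr⟩ := hstep
    exact ⟨μ, hμ, .head hw.bestStep hr⟩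
  refine ih _ (Finset.sum_lt_sum (s := Finset.univ)
      (f := fun g => if l.satisfy f w g = none then 0 else 1 + M.firmRank g (l.satisfy f w g))
      ?_ ⟨f, Finset.mem_univ _, ?_⟩) (l.satisfy f w) rfl
  · intro g _
    by_cases hg : g = f
    · subst hg
      simpa [Matching.satisfy_apply, hf] using (firmRank_lt hw.1.2.1).le
    · simp only [Matching.satisfy_apply, if_neg hg]
      split_ifs <;> simp_all
  · simpa [Matching.satisfy_apply, hf] using firmRank_lt hw.1.2.1

/-- A single firm would block with any single worker, so every worker would be matched; as the sides
have equal size, the workers' partners then exhaust the firms. -/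
theorem Stable.exists_partner [Fintype F] [Fintype W] (hacc : M.AllAcceptable)
    (hbal : Fintype.card F = Fintype.card W) {μ : Matching F W} (h : M.Stable μ) (f : F) :
    ∃ w, μ f = some w := by
  by_contra hf
  have hf : μ f = none := by
    rcases hx : μ f with _ | w
    · rfl
    · exact absurd ⟨w, hx⟩ hf
  have hw : ∀ w, ∃ g, μ.symm w = some g := by
    intro w
    rcases hx : μ.symm w with _ | g
    · exact absurd ⟨by simp [hf], hf ▸ (hacc f w).1, hx ▸ (hacc f w).2⟩ (h f w)
    · exact ⟨g, rfl⟩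
  choose p hp using hw
  have hinj : Function.Injective p := fun v w hvw => by
    have h1 := μ.eq_some_iff.1 (hp v)
    have h2 := μ.eq_some_iff.1 (hp w)
    rw [hvw] at h1
    simpa using h1.symm.trans h2
  obtain ⟨w, rfl⟩ := ((Fintype.bijective_iff_injective_and_card p).2 ⟨hinj, hbal.symm⟩).2 f
  simp [μ.eq_some_iff.1 (hp w)] at hf

end Market

/-! ### Moving the hole -/

namespace Market

variable {F W : Type*} {M : Market F W}

theorem bestStep_remove (hacc : M.AllAcceptable) {μ : Matching F W} (hμ : M.Stable μ) {f : F}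
    {w : W} (hw : μ f = some w) : M.BestStep (μ.remove f) μ := by
  have hf : μ.remove f f = none := by simp [Matching.remove_apply]
  have hws : (μ.remove f).symm w = none := by simp [Matching.remove_symm_apply, hw]
  have hbl : M.Blocking (μ.remove f) f w :=
    ⟨by simp [hf], hf ▸ (hacc f w).1, hws ▸ (hacc f w).2⟩
  refine ⟨f, w, .inl ⟨hbl, fun v hv hvw => ?_⟩, hw, ?_, ?_, ?_, ?_⟩
  · have h := hv.2.2
    rw [Matching.remove_symm_apply, if_neg (by simpa [hw] using hvw.symm)] at h
    exact hw ▸ hμ.firmPref_of_workerPref h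
  · simp [hws]
  · simp [hf]
  · intro g hg _
    simp [Matching.remove_apply, hg]
  · intro v hv _
    rw [Matching.remove_symm_apply, if_neg (by simpa [hw] using hv.symm)]

/-- A partner abandoned in the final step would be single in a stable matching, which is perfect.
Hence both members of the final pair were single before. -/
theorem AlmostStable.exists_eq_remove [Fintype F] [Fintype W] (hacc : M.AllAcceptable)
    (hbal : Fintype.card F = Fintype.card W) {l : Matching F W} (h : M.AlmostStable l) :
    ∃ μ f, M.Stable μ ∧ l = μ.remove f := by
  obtain ⟨μ, hμ, f, w, -, hs⟩ := h
  have hw : l.symm w = none := by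
    rcases hx : l.symm w with _ | g
    · rfl
    · obtain ⟨v, hv⟩ := hμ.exists_partner hacc hbal g
      simp [hs.firm_divorced g hx] at hv
  have hf : l f = none := by
    rcases hx : l f with _ | v
    · rfl
    · obtain ⟨g, hg⟩ := hμ.swap.exists_partner hacc.swap hbal.symm v
      simp [hs.worker_divorced v hx] at hg
  refine ⟨μ, f, hμ, PEquiv.ext fun g => ?_⟩
  rw [Matching.remove_apply]
  split_ifs with hg
  · rw [hg, hf]
  · exact (hs.firm_other g hg (by simp [hw])).symm

/-- Two steps: `g` leaves its partner for the single `w`, the only worker it can block with; then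
`w` returns to `f`, whom `w` ranks above every other firm that wants `w`, by stability of `μ`. This
leaves `g` and its old partner single. -/
theorem bestReaches_remove_of_firmPref (hacc : M.AllAcceptable) {μ : Matching F W}
    (hμ : M.Stable μ) {f g : F} {w : W} (hw : μ f = some w)
    (h : M.firmPref g (some w) (μ g)) : M.BestReaches (μ.remove f) (μ.remove g) := by
  have hgf : g ≠ f := fun e => firmPref_irrefl f (some w) (by rw [e, hw] at h; exact h)
  have hsf : μ.symm w = some f := μ.eq_some_iff.2 hw
  have hf : μ.remove f f = none := by simp [Matching.remove_apply]
  have hg : ∀ k, k ≠ f → μ.remove f k = μ k := fun k hk => by simp [Matching.remove_apply, hk]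
  have hws : (μ.remove f).symm w = none := by simp [Matching.remove_symm_apply, hw]
  have hne : ∀ k, μ.remove f k ≠ some w := fun k e => by
    simp [(μ.remove f).eq_some_iff.2 e] at hws
  have h1 : M.BestForFirm (μ.remove f) g w := by
    refine ⟨⟨hne g, hg g hgf ▸ h, hws ▸ (hacc g w).2⟩, fun v hv hvw => ?_⟩
    obtain ⟨h1, h2, h3⟩ := hv
    rw [hg g hgf] at h1 h2
    rw [Matching.remove_symm_apply, if_neg (by simpa [hw] using hvw.symm)] at h3
    exact absurd ⟨h1, h2, h3⟩ (hμ g v)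
  set m := (μ.remove f).satisfy g w with hm
  have hmf : m f = none := by simp [hm, Matching.satisfy_apply, hgf.symm, hf]
  have hmg : m g = some w := by simp [hm, Matching.satisfy_apply]
  have hmk : ∀ k, k ≠ f → k ≠ g → m k = μ k := fun k hk hk' => by
    rw [hm, Matching.satisfy_apply, if_neg hk', if_neg (hne k), hg k hk]
  have hmw : m.symm w = some g := m.eq_some_iff.2 hmg
  have h2 : M.BestForWorker m f w := by
    refine ⟨⟨by simp [hmf], hmf ▸ (hacc f w).1, ?_⟩, fun k hk hkf => ?_⟩
    · rw [hmw, ← hsf]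
      exact hμ.workerPref_of_firmPref h
    · have hkg : k ≠ g := fun e => hk.1 (e ▸ hmg)
      have h3 := hk.2.1
      rw [hmk k hkf hkg] at h3
      exact hsf ▸ hμ.workerPref_of_firmPref h3
  have h3 : m.satisfy f w = μ.remove g := by
    refine PEquiv.ext fun k => ?_
    rw [Matching.satisfy_apply, Matching.remove_apply]
    by_cases hkf : k = f
    · subst hkf; simp [hgf.symm, hw]
    · by_cases hkg : k = g
      · subst hkg; simp [hkf, hmg]
      · rw [if_neg hkf, if_neg hkg, hmk k hkf hkg, if_neg]
        intro e
        exact hkf (by simpa [hsf, eq_comm] using μ.eq_some_iff.2 e)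
  exact .head h1.bestStep (.single (h3 ▸ h2.bestStep))

theorem bestReaches_remove_of_workerPref (hacc : M.AllAcceptable) {μ : Matching F W}
    (hμ : M.Stable μ) {f g : F} {w v : W} (hw : μ f = some w) (hv : μ g = some v)
    (h : M.workerPref v (some f) (some g)) : M.BestReaches (μ.remove f) (μ.remove g) := by
  have h1 : M.swap.BestReaches _ _ := bestReaches_remove_of_firmPref (M := M.swap) hacc.swap
    hμ.swap (f := w) (g := v) (w := f) (μ.eq_some_iff.2 hw) (by rw [μ.eq_some_iff.2 hv]; exact h)
  rw [← Matching.remove_symm hw, ← Matching.remove_symm hv] at h1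
  exact BestReaches.swap (M := M.swap) h1

/-- The firm `g` with its partner `v` envies the firm `f` with its partner `w`: either `g` prefers
`w` to `v`, or `v` prefers `f` to `g`. -/
def Envies (M : Market F W) (μ : Matching F W) (g f : F) : Prop :=
  ∃ v w, μ g = some v ∧ μ f = some w ∧
    (M.firmPref g (some w) (some v) ∨ M.workerPref v (some f) (some g))

theorem bestReaches_remove_of_envies (hacc : M.AllAcceptable) {μ : Matching F W}
    (hμ : M.Stable μ) {f g : F} (h : Relation.ReflTransGen (M.Envies μ) g f) :
    M.BestReaches (μ.remove f) (μ.remove g) := by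
  induction h with
  | refl => exact .refl
  | tail _ h ih =>
    obtain ⟨v, w, hv, hw, h | h⟩ := h
    · exact (bestReaches_remove_of_firmPref hacc hμ hw (hv ▸ h)).trans ih
    · exact (bestReaches_remove_of_workerPref hacc hμ hw hv h).trans ih

/-! ### Lattice structure of stable matchings -/

/-- All firms weakly prefer `μ'` to `μ`. -/
def FirmsLE (M : Market F W) (μ μ' : Matching F W) : Prop := ∀ f, ¬ M.firmPref f (μ f) (μ' f)

/-- Opposition of interests: a worker gaining at `μ'` would be taken by a firm that, by stability of
`μ`, loses there. -/
theorem FirmsLE.swap (hacc : M.AllAcceptable) {μ μ' : Matching F W} (hμ : M.Stable μ) (h : M.FirmsLE μ μ') :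
    M.swap.FirmsLE μ'.symm μ.symm := by
  intro w hw
  change M.workerPref w (μ'.symm w) (μ.symm w) at hw
  rcases hx : μ'.symm w with _ | f
  · rw [hx] at hw
    rcases hy : μ.symm w with _ | g
    · exact workerPref_irrefl w none (by rwa [hy] at hw)
    · exact workerPref_asymm (hacc g w).2 (by rwa [hy] at hw)
  · rw [hx] at hw
    have := hμ.firmPref_of_workerPref hw
    rw [← μ'.eq_some_iff.1 hx] at this
    exact h f this

/-- The join gives each firm the better of its two partners. -/
theorem exists_stable_sup [Fintype F] [Fintype W] (hacc : M.AllAcceptable)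
    (hbal : Fintype.card F = Fintype.card W) {μ₁ μ₂ : Matching F W} (h₁ : M.Stable μ₁)
    (h₂ : M.Stable μ₂) : ∃ μ, M.Stable μ ∧ M.FirmsLE μ₁ μ ∧ M.FirmsLE μ₂ μ := by
  have hm : ∀ f, ∃ w, (μ₁ f = some w ∨ μ₂ f = some w) ∧ ¬ M.firmPref f (μ₁ f) (some w) ∧
      ¬ M.firmPref f (μ₂ f) (some w) := by
    intro f
    obtain ⟨w₁, hw₁⟩ := h₁.exists_partner hacc hbal f
    obtain ⟨w₂, hw₂⟩ := h₂.exists_partner hacc hbal f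
    rw [hw₁, hw₂]
    by_cases h : M.firmPref f (some w₁) (some w₂)
    · exact ⟨w₁, .inl rfl, firmPref_irrefl _ _, firmPref_asymm h⟩
    · exact ⟨w₂, .inr rfl, h, firmPref_irrefl _ _⟩
  choose m hm hm₁ hm₂ using hm
  -- If two firms both picked `w`, one from each matching, stability of each matching would make `w`
  -- prefer the other matching's firm, a contradiction.
  have key : ∀ {μ₁ μ₂ : Matching F W}, M.Stable μ₁ → M.Stable μ₂ → ∀ {f g w},
      μ₁ f = some w → μ₂ g = some w → ¬ M.firmPref f (μ₂ f) (some w) →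
      ¬ M.firmPref g (μ₁ g) (some w) → f = g := by
    intro μ₁ μ₂ h₁ h₂ f g w hf hg hf' hg'
    by_contra hne
    have hf2 : μ₂ f ≠ some w := fun e => hne <| by
      simpa using (μ₂.eq_some_iff.2 e).symm.trans (μ₂.eq_some_iff.2 hg)
    have hg1 : μ₁ g ≠ some w := fun e => hne <| by
      simpa using (μ₁.eq_some_iff.2 hf).symm.trans (μ₁.eq_some_iff.2 e)
    have a := h₂.workerPref_of_firmPref ((firmPref_total f hf2).resolve_left hf')
    have b := h₁.workerPref_of_firmPref ((firmPref_total g hg1).resolve_left hg')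
    rw [μ₂.eq_some_iff.2 hg] at a
    rw [μ₁.eq_some_iff.2 hf] at b
    exact workerPref_asymm a b
  have hinj : Function.Injective m := by
    intro f g hfg
    have hg₁ := hm₁ g
    have hg₂ := hm₂ g
    rw [← hfg] at hg₁ hg₂
    rcases hm f with hf | hf <;> rcases hm g with hg | hg <;> rw [← hfg] at hg
    · simpa using (μ₁.eq_some_iff.2 hf).symm.trans (μ₁.eq_some_iff.2 hg)
    · exact key h₁ h₂ hf hg (hm₂ f) hg₁
    · exact key h₂ h₁ hf hg (hm₁ f) hg₂
    · simpa using (μ₂.eq_some_iff.2 hf).symm.trans (μ₂.eq_some_iff.2 hg)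
  let e : F ≃ W := Equiv.ofBijective m ((Fintype.bijective_iff_injective_and_card m).2 ⟨hinj, hbal⟩)
  have he : ∀ f, e.toPEquiv f = some (m f) := fun f => rfl
  refine ⟨e.toPEquiv, ?_, fun f => he f ▸ hm₁ f, fun f => he f ▸ hm₂ f⟩
  rintro f w ⟨-, hf, hw⟩
  rw [he] at hf
  obtain ⟨g, rfl⟩ := e.surjective w
  change M.firmPref f (some (m g)) _ at hf
  have hs : e.toPEquiv.symm (e g) = some g := e.toPEquiv.eq_some_iff.2 rfl
  rw [hs] at hw
  change M.workerPref (m g) _ _ at hw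
  have key2 : ∀ {μ : Matching F W}, M.Stable μ → ¬ M.firmPref f (μ f) (some (m f)) →
      μ g = some (m g) → False := by
    intro μ hμ h1 h2
    have h3 := hμ.firmPref_of_workerPref (f := f) (w := m g) (by rwa [μ.eq_some_iff.2 h2])
    exact h1 (firmPref_trans h3 hf)
  rcases hm g with hg | hg
  · exact key2 h₁ (hm₁ f) hg
  · exact key2 h₂ (hm₂ f) hg

/-! ### Deferred acceptance from a hole -/

/-- Deferred acceptance by the workers that starts with the single worker `u`. The firm `f` stays
single and only listens to workers it prefers to `a`; it is chosen in the end. -/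
theorem exists_stable_bestReaches_remove [Fintype F] [Fintype W] (hacc : M.AllAcceptable)
    (hbal : Fintype.card F = Fintype.card W) {μ J : Matching F W} (hJ : M.Stable J)
    (hμJ : M.FirmsLE μ J) {f : F} (hfJ : μ f ≠ J f) (l : Matching F W) (u : W)
    (hf : l f = none) (hu : l.symm u = none) (hl : ∀ g, g ≠ f → l g ≠ none)
    (hb : ∀ g v, g ≠ f → v ≠ u → ¬ M.Blocking l g v)
    (hbf : ∀ v, v ≠ u → M.workerPref v (some f) (l.symm v) → ¬ M.firmPref f (some v) (μ f))
    (hlow : ∀ g, g ≠ f → ¬ M.firmPref g (μ g) (l g))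
    (hup : ∀ g, g ≠ f → ¬ M.firmPref g (l g) (J g)) :
    ∃ μ', M.Stable μ' ∧ M.FirmsLE μ μ' ∧ M.FirmsLE μ' J ∧ M.firmPref f (μ' f) (μ f) ∧
      M.BestReaches l (μ'.remove f) := by
  induction hn : ∑ g, M.firmRank g (l g) using Nat.strong_induction_on generalizing l u with
  | _ n ih =>
  subst hn
  have hlu : ∀ g, l g ≠ some u := fun g e => by simp [l.eq_some_iff.2 e] at hu
  obtain ⟨h, hh⟩ := hJ.swap.exists_partner hacc.swap hbal.symm u
  have hJh : J h = some u := J.eq_some_iff.1 hh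
  have hcand : (h = f ∧ M.firmPref h (some u) (μ f)) ∨ (h ≠ f ∧ M.firmPref h (some u) (l h)) := by
    by_cases hhf : h = f
    · have := (firmPref_total (M := M) f hfJ).resolve_left (hμJ f)
      rw [← hhf, hJh] at this
      exact .inl ⟨hhf, hhf ▸ this⟩
    · have := (firmPref_total (M := M) h (hlu h)).resolve_left (hJh ▸ hup h hhf)
      exact .inr ⟨hhf, this⟩
  obtain ⟨g, hg, hbest⟩ := exists_best_firm (M := M) u
    (p := fun k => (k = f ∧ M.firmPref k (some u) (μ f)) ∨ (k ≠ f ∧ M.firmPref k (some u) (l k)))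
    ⟨h, hcand⟩
  -- The `J`-partner of `u` is always a candidate, so `u` never goes below it; a firm rising above
  -- its own `J`-partner through `u` would then block `J`.
  have hgJ : ¬ M.firmPref g (some u) (J g) := by
    intro hp
    have h1 := hJ.workerPref_of_firmPref hp
    have h2 : h ≠ g := fun e => firmPref_irrefl g (some u) (by rw [← e, hJh] at hp; exact e ▸ hp)
    have hh' : J.symm u = some h := hh
    rw [hh'] at h1
    exact workerPref_asymm h1 (hbest h hcand h2)
  set m := l.satisfy g u with hm
  have hmg : m g = some u := by simp [hm, Matching.satisfy_apply]
  have hmk : ∀ k, k ≠ g → m k = l k := fun k hk => by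
    rw [hm, Matching.satisfy_apply, if_neg hk, if_neg (hlu k)]
  have hmu : m.symm u = some g := m.eq_some_iff.2 hmg
  -- If `u` chooses `f`, filling the hole gives a stable matching and `l` already is that matching
  -- with the hole. Otherwise `g` takes `u` and drops its worker `x`, who becomes the next single
  -- worker.
  rcases hg with ⟨rfl, hgu⟩ | ⟨hgf, hgu⟩
  · have hmv : ∀ v, v ≠ u → m.symm v = l.symm v := fun v hv => by
      rw [hm, Matching.satisfy_symm_apply, if_neg hv, if_neg (by simp [hf])]
    refine ⟨m, ?_, ?_, ?_, hmg ▸ hgu, ?_⟩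
    · rintro k v ⟨h1, h2, h3⟩
      by_cases hkg : k = g
      · subst hkg
        have hvu : v ≠ u := fun e => h1 (e ▸ hmg)
        rw [hmg] at h2
        rw [hmv v hvu] at h3
        exact hbf v hvu h3 (firmPref_trans h2 hgu)
      · rw [hmk k hkg] at h1 h2
        by_cases hvu : v = u
        · subst hvu
          rw [hmu] at h3
          exact workerPref_asymm h3 (hbest k (.inr ⟨hkg, h2⟩) hkg)
        · rw [hmv v hvu] at h3
          exact hb k v hkg hvu ⟨h1, h2, h3⟩
    · intro k
      by_cases hkg : k = g
      · subst hkg; exact hmg ▸ firmPref_asymm hgu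
      · exact hmk k hkg ▸ hlow k hkg
    · intro k
      by_cases hkg : k = g
      · subst hkg; exact hmg ▸ hgJ
      · exact hmk k hkg ▸ hup k hkg
    · have : m.remove g = l := by
        refine PEquiv.ext fun k => ?_
        rw [Matching.remove_apply]
        split_ifs with hkg
        · rw [hkg, hf]
        · exact hmk k hkg
      rw [this]
      exact .refl
  · obtain ⟨x, hx⟩ : ∃ x, l g = some x := Option.ne_none_iff_exists'.1 (hl g hgf)
    have hxu : x ≠ u := fun e => hlu g (e ▸ hx)
    have hmv : ∀ v, v ≠ u → v ≠ x → m.symm v = l.symm v := fun v hv hvx => by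
      rw [hm, Matching.satisfy_symm_apply, if_neg hv, if_neg (by simpa [hx] using hvx.symm)]
    have hmx : m.symm x = none := by
      rw [hm, Matching.satisfy_symm_apply, if_neg hxu, if_pos hx]
    have hstep : M.BestForFirm l g u := by
      refine ⟨⟨hlu g, hgu, hu ▸ (hacc g u).2⟩, fun v hv hvu => absurd hv (hb g v hgf hvu)⟩
    suffices hrec : ∃ μ', M.Stable μ' ∧ M.FirmsLE μ μ' ∧ M.FirmsLE μ' J ∧
        M.firmPref f (μ' f) (μ f) ∧ M.BestReaches m (μ'.remove f) by
      obtain ⟨μ', h1, h2, h3, h4, h5⟩ := hrec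
      exact ⟨μ', h1, h2, h3, h4, .head hstep.bestStep h5⟩
    refine ih _ (Finset.sum_lt_sum (s := Finset.univ) (f := fun k => M.firmRank k (m k)) ?_
      ⟨g, Finset.mem_univ _, ?_⟩) m x ?_ hmx ?_ ?_ ?_ ?_ ?_ rfl
    · intro k _
      by_cases hkg : k = g
      · subst hkg; rw [hmg]; exact (firmRank_lt hgu).le
      · rw [hmk k hkg]
    · rw [hmg]; exact firmRank_lt hgu
    · rw [hmk f hgf.symm, hf]
    · intro k hkf
      by_cases hkg : k = g
      · subst hkg; simp [hmg]
      · exact hmk k hkg ▸ hl k hkf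
    · rintro k v hkf hvx ⟨h1, h2, h3⟩
      by_cases hkg : k = g
      · subst hkg
        have hvu : v ≠ u := fun e => h1 (e ▸ hmg)
        rw [hmg] at h2
        rw [hmv v hvu hvx] at h3
        exact hb k v hkf hvu ⟨by simpa [hx] using hvx.symm, firmPref_trans h2 hgu, h3⟩
      · rw [hmk k hkg] at h1 h2
        by_cases hvu : v = u
        · subst hvu
          rw [hmu] at h3
          exact workerPref_asymm h3 (hbest k (.inr ⟨hkf, h2⟩) hkg)
        · rw [hmv v hvu hvx] at h3
          exact hb k v hkf hvu ⟨h1, h2, h3⟩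
    · intro v hvx hv hp
      by_cases hvu : v = u
      · subst hvu
        rw [hmu] at hv
        exact workerPref_asymm hv (hbest f (.inl ⟨rfl, hp⟩) hgf.symm)
      · rw [hmv v hvu hvx] at hv
        exact hbf v hvu hv hp
    · intro k hkf
      by_cases hkg : k = g
      · subst hkg
        rw [hmg]
        intro hp
        exact hlow k hkf (firmPref_trans hp hgu)
      · exact hmk k hkg ▸ hlow k hkf
    · intro k hkf
      by_cases hkg : k = g
      · subst hkg; exact hmg ▸ hgJ
      · exact hmk k hkg ▸ hup k hkf

end Market

/-! ### From absence of non-trivial fragments to reachability -/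

namespace Market

variable {F W : Type*} {M : Market F W}

/-- If some `f` is missed, the firms reachable from `k` are closed under envy: they and their
partners prefer their matches to all outsiders. They form a fragment, non-trivial because `μ` and
`J` differ at `k`. -/
theorem reflTransGen_envies [Fintype F] [Fintype W] (hacc : M.AllAcceptable)
    (hbal : Fintype.card F = Fintype.card W)
    (hfrag : ∀ (A : Finset F) (B : Finset W), ¬ M.IsNontrivialFragment A B)
    {μ J : Matching F W} (hμ : M.Stable μ) (hJ : M.Stable J) {k : F} (hk : μ k ≠ J k) (f : F) :
    Relation.ReflTransGen (M.Envies μ) k f := by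
  classical
  by_contra hf
  choose m hm using hμ.exists_partner hacc hbal
  have hinj : Function.Injective m := fun g h hgh => by
    have h1 := μ.eq_some_iff.2 (hm g)
    rw [hgh, μ.eq_some_iff.2 (hm h)] at h1
    simpa using h1.symm
  have hms : ∀ g, μ.symm (m g) = some g := fun g => μ.eq_some_iff.2 (hm g)
  let A : Finset F := Finset.univ.filter (Relation.ReflTransGen (M.Envies μ) k)
  let B : Finset W := A.image m
  have hA : ∀ {g}, g ∈ A ↔ Relation.ReflTransGen (M.Envies μ) k g := by simp [A]
  have hB : ∀ {g}, m g ∈ B ↔ g ∈ A := by simp [B, hinj.eq_iff]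
  have hclosed : ∀ g ∈ A, ∀ h, h ∉ A → ¬ M.firmPref g (some (m h)) (some (m g)) ∧
      ¬ M.workerPref (m g) (some h) (some g) := fun g hg h hh =>
    ⟨fun hp => hh (hA.2 ((hA.1 hg).tail ⟨m g, m h, hm g, hm h, .inl hp⟩)),
      fun hp => hh (hA.2 ((hA.1 hg).tail ⟨m g, m h, hm g, hm h, .inr hp⟩))⟩
  have hsurj : Function.Surjective m :=
    ((Fintype.bijective_iff_injective_and_card m).2 ⟨hinj, hbal⟩).2
  let e : A ≃ B := Equiv.ofBijective (fun a => ⟨m a, hB.2 a.2⟩) <| by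
    refine ⟨fun a b hab => Subtype.ext (hinj (by simpa using hab)), ?_⟩
    rintro ⟨b, hb⟩
    obtain ⟨a, ha, rfl⟩ := Finset.mem_image.1 hb
    exact ⟨⟨a, ha⟩, rfl⟩
  have he : ∀ a, (e.toPEquiv a).map Subtype.val = μ a := fun a => (hm a).symm
  have hes : ∀ b, (e.toPEquiv.symm b).map Subtype.val = μ.symm b := by
    intro b
    obtain ⟨a, rfl⟩ := e.surjective b
    have h1 : e.toPEquiv.symm (e a) = some a := e.toPEquiv.eq_some_iff.2 rfl
    rw [h1]
    exact (hms a).symm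
  have hfA : f ∉ A := fun h => hf (hA.1 h)
  refine hfrag A B ⟨⟨?_, ?_, ?_, e.toPEquiv, ?_, ?_, ?_⟩, ?_⟩
  · exact (Finset.ssubset_univ_iff).2 fun h => hfA (h ▸ Finset.mem_univ f)
  · exact (Finset.ssubset_univ_iff).2 fun h => hfA (hB.1 (h ▸ Finset.mem_univ (m f)))
  · exact (Finset.card_image_of_injective A hinj).symm
  · rintro a b ⟨-, h2, h3⟩
    change M.firmPref a (some b) ((e.toPEquiv a).map Subtype.val) at h2
    change M.workerPref b (some a) ((e.toPEquiv.symm b).map Subtype.val) at h3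
    rw [he] at h2
    rw [hes] at h3
    exact workerPref_asymm h3 (hμ.workerPref_of_firmPref h2)
  · intro a w hw
    obtain ⟨h, rfl⟩ := hsurj w
    have hh : h ∉ A := fun hh => hw (hB.2 hh)
    have hne : m a ≠ m h := fun e => hh (hinj e ▸ a.2)
    rw [he, hm]
    exact (firmPref_total _ (by simpa using hne)).resolve_right (hclosed a a.2 h hh).1
  · rintro ⟨w, hw⟩ h hh
    obtain ⟨a, rfl⟩ := hsurj w
    have ha : a ∈ A := hB.1 hw
    have hne : a ≠ h := fun e => hh (e ▸ ha)
    rw [hes, hms]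
    exact (workerPref_total _ (by simpa using hne)).resolve_right (hclosed a ha h hh).2
  · intro h
    exact hk ((h μ J hμ hJ).1 k (hA.2 .refl))

/-- From a stable matching with one pair separated, every firm that is not matched in the same way
by all stable matchings can be made the separated one. -/
def MovableHole (M : Market F W) : Prop :=
  ∀ μ J : Matching F W, M.Stable μ → M.Stable J → ∀ k f, μ k ≠ J k →
    M.BestReaches (μ.remove f) (μ.remove k)

theorem MovableHole.swap [Fintype F] [Fintype W] (hacc : M.AllAcceptable)
    (hbal : Fintype.card F = Fintype.card W) (h : M.MovableHole) : M.swap.MovableHole := by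
  intro μ J hμ hJ w v hw
  obtain ⟨f, hf⟩ := hμ.exists_partner hacc.swap hbal.symm w
  obtain ⟨g, hg⟩ := hμ.exists_partner hacc.swap hbal.symm v
  have hf' := μ.eq_some_iff.2 hf
  have hg' := μ.eq_some_iff.2 hg
  have h1 := (h μ.symm J.symm hμ.swap hJ.swap f g ?_).swap
  · rwa [Matching.remove_symm hf', Matching.remove_symm hg'] at h1
  · intro e
    rw [hf'] at e
    exact hw (hf.trans (J.eq_some_iff.1 e.symm).symm)

/-- Move the hole to a firm `k` on which `μ` and `J` differ, run deferred acceptance there, and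
repeat with the resulting matching, still below `J` and strictly better for `k`. -/
theorem exists_bestReaches_of_firmsLE [Fintype F] [Fintype W] (hacc : M.AllAcceptable)
    (hbal : Fintype.card F = Fintype.card W) (hmove : M.MovableHole) {μ J : Matching F W}
    (hμ : M.Stable μ) (hJ : M.Stable J) (hle : M.FirmsLE μ J) (f : F) :
    ∃ g, M.BestReaches (μ.remove f) (J.remove g) := by
  induction hn : ∑ g, M.firmRank g (μ g) using Nat.strong_induction_on generalizing μ f with
  | _ n ih =>
  subst hn
  by_cases hμJ : ∀ k, μ k = J k
  · exact ⟨f, PEquiv.ext hμJ ▸ .refl⟩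
  push Not at hμJ
  obtain ⟨k, hk⟩ := hμJ
  obtain ⟨u, hu⟩ := hμ.exists_partner hacc hbal k
  have hrem : ∀ g, g ≠ k → μ.remove k g = μ g := fun g hg => by simp [Matching.remove_apply, hg]
  have hrems : ∀ v, v ≠ u → (μ.remove k).symm v = μ.symm v := fun v hv => by
    rw [Matching.remove_symm_apply, if_neg (by simpa [hu] using hv.symm)]
  obtain ⟨μ', h1, h2, h3, h4, h5⟩ := exists_stable_bestReaches_remove hacc hbal hJ hle hk
    (μ.remove k) u (by simp [Matching.remove_apply]) (by simp [Matching.remove_symm_apply, hu])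
    (fun g hg => by
      obtain ⟨v, hv⟩ := hμ.exists_partner hacc hbal g
      simp [hrem g hg, hv])
    (fun g v hg hv hb => hμ g v ⟨hrem g hg ▸ hb.1, hrem g hg ▸ hb.2.1, hrems v hv ▸ hb.2.2⟩)
    (fun v hv hp => firmPref_asymm (hμ.firmPref_of_workerPref (hrems v hv ▸ hp)))
    (fun g hg => hrem g hg ▸ firmPref_irrefl _ _) (fun g hg => hrem g hg ▸ hle g)
  obtain ⟨g, hg⟩ := ih _ (Finset.sum_lt_sum (fun i _ => firmRank_le (h2 i))
    ⟨k, Finset.mem_univ _, firmRank_lt h4⟩) h1 h3 k rfl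
  exact ⟨g, (hmove μ J hμ hJ k f hk).trans (h5.trans hg)⟩

theorem bestReaches_of_almostStable [Fintype F] [Fintype W] (hacc : M.AllAcceptable)
    (hbal : Fintype.card F = Fintype.card W)
    (hfrag : ∀ (A : Finset F) (B : Finset W), ¬ M.IsNontrivialFragment A B)
    {l μ : Matching F W} (hl : M.AlmostStable l) (hμ : M.Stable μ) : M.BestReaches l μ := by
  have hmove : M.MovableHole := fun μ J hμ hJ k f hk =>
    bestReaches_remove_of_envies hacc hμ (reflTransGen_envies hacc hbal hfrag hμ hJ hk f)
  obtain ⟨μ₀, f, hμ₀, rfl⟩ := hl.exists_eq_remove hacc hbal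
  obtain ⟨J, hJ, h₀, h₁⟩ := exists_stable_sup hacc hbal hμ₀ hμ
  obtain ⟨g, hg⟩ := exists_bestReaches_of_firmsLE hacc hbal hmove hμ₀ hJ h₀ f
  obtain ⟨w, hw⟩ := hJ.exists_partner hacc hbal g
  -- The descent from `J` to `μ` is an ascent for the workers.
  obtain ⟨v, hv⟩ := exists_bestReaches_of_firmsLE (M := M.swap) hacc.swap hbal.symm
    (hmove.swap hacc hbal) hJ.swap hμ.swap (h₁.swap hacc hμ) w
  obtain ⟨h, hh⟩ := hμ.swap.exists_partner hacc.swap hbal.symm v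
  have hh' : μ h = some v := μ.eq_some_iff.1 hh
  rw [← Matching.remove_symm hw, ← Matching.remove_symm hh'] at hv
  exact (hg.trans (BestReaches.swap (M := M.swap) hv)).tail (bestStep_remove hacc hμ hh')

/-! ### Fragments are absorbing -/

/-- `l` matches the agents in `(A, B)` as `ν` does. -/
def Extends {A : Finset F} {B : Finset W} (l : Matching F W) (ν : Matching A B) : Prop :=
  (∀ a : A, l a = (ν a).map Subtype.val) ∧ ∀ b : B, l.symm b = (ν.symm b).map Subtype.val

/-- A blocking pair inside the fragment would contradict stability of `ν`, and one across its border
the preference of insiders for their partners. So both members lie outside, as do their old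
partners. -/
theorem Extends.step {A : Finset F} {B : Finset W} {ν : Matching A B} (hν : M.Induces A B ν)
    {l m : Matching F W} (hl : Extends l ν) (h : M.Step l m) : Extends m ν := by
  obtain ⟨f, w, hb, hs⟩ := h
  obtain ⟨hst, hA, hB⟩ := hν
  have hf : f ∉ A := by
    intro hf
    by_cases hw : w ∈ B
    · refine hst ⟨f, hf⟩ ⟨w, hw⟩ ⟨fun e => hb.1 ?_, ?_, ?_⟩
      · rw [hl.1 ⟨f, hf⟩, e]; rfl
      · have h1 := hb.2.1
        rwa [hl.1 ⟨f, hf⟩] at h1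
      · have h1 := hb.2.2
        rwa [hl.2 ⟨w, hw⟩] at h1
    · exact firmPref_asymm (hA ⟨f, hf⟩ w hw) (hl.1 ⟨f, hf⟩ ▸ hb.2.1)
  have hw : w ∉ B := fun hw =>
    workerPref_asymm (hB ⟨w, hw⟩ f hf) (hl.2 ⟨w, hw⟩ ▸ hb.2.2)
  constructor
  · intro a
    rw [hs.firm_other a (fun e => hf (e ▸ a.2)), hl.1]
    intro e
    have h1 := l.eq_some_iff.1 e
    rw [hl.1, Option.map_eq_some_iff] at h1
    obtain ⟨b, -, rfl⟩ := h1
    exact hw b.2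
  · intro b
    rw [hs.worker_other b (fun e => hw (e ▸ b.2)), hl.2]
    intro e
    have h1 := l.eq_some_iff.2 e
    rw [hl.2, Option.map_eq_some_iff] at h1
    obtain ⟨a, -, rfl⟩ := h1
    exact hf a.2

theorem Extends.reaches {A : Finset F} {B : Finset W} {ν : Matching A B} (hν : M.Induces A B ν)
    {l m : Matching F W} (hl : Extends l ν) (h : M.Reaches l m) : Extends m ν := by
  induction h with
  | refl => exact hl
  | tail _ h ih => exact ih.step hν h

theorem Extends.eq {A : Finset F} {B : Finset W} {ν : Matching A B} {l m : Matching F W}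
    (hl : Extends l ν) (hm : Extends m ν) :
    (∀ f ∈ A, l f = m f) ∧ ∀ w ∈ B, l.symm w = m.symm w :=
  ⟨fun f hf => (hl.1 ⟨f, hf⟩).trans (hm.1 ⟨f, hf⟩).symm,
    fun w hw => (hl.2 ⟨w, hw⟩).trans (hm.2 ⟨w, hw⟩).symm⟩

theorem exists_extends {A : Finset F} {B : Finset W} (ν : Matching A B) :
    ∃ l : Matching F W, Extends l ν := by
  classical
  let l : Matching F W :=
    { toFun f := if hf : f ∈ A then (ν ⟨f, hf⟩).map Subtype.val else none
      invFun w := if hw : w ∈ B then (ν.symm ⟨w, hw⟩).map Subtype.val else none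
      inv f w := by
        have h1 := fun a b => ν.eq_some_iff (a := a) (b := b)
        change _ = some f ↔ _ = some w
        split_ifs <;> simp only [Option.map_eq_some_iff, Subtype.exists, exists_and_right,
          exists_eq_right, h1] <;> grind }
  exact ⟨l, fun a => dif_pos a.2, fun b => dif_pos b.2⟩

theorem not_isNontrivialFragment [Fintype F] [Fintype W] (hacc : M.AllAcceptable)
    (hbal : Fintype.card F = Fintype.card W)
    (h : ∀ l μ : Matching F W, M.AlmostStable l → M.Stable μ → M.Reaches l μ)
    (A : Finset F) (B : Finset W) : ¬ M.IsNontrivialFragment A B := by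
  rintro ⟨⟨hA, -, -, ν, hν⟩, hnt⟩
  obtain ⟨l₀, hl₀⟩ := exists_extends ν
  obtain ⟨μ₀, hμ₀, hr⟩ := exists_stable_bestReaches (M := M) l₀
  have hext := hl₀.reaches hν hr.reaches
  -- Properness of the fragment supplies an outside pair to separate.
  obtain ⟨f, -, hf⟩ := Finset.exists_of_ssubset hA
  obtain ⟨w, hw⟩ := hμ₀.exists_partner hacc hbal f
  have hrem : Extends (μ₀.remove f) ν := by
    refine ⟨fun a => ?_, fun b => ?_⟩
    · rw [← hext.1, Matching.remove_apply, if_neg (fun e : a.1 = f => hf (e ▸ a.2))]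
    · rw [← hext.2, Matching.remove_symm_apply, if_neg]
      intro e
      have h1 := μ₀.eq_some_iff.2 e
      rw [hext.2, Option.map_eq_some_iff] at h1
      obtain ⟨a, -, rfl⟩ := h1
      exact hf a.2
  have hall : ∀ μ, M.Stable μ → Extends μ ν := fun μ hμ =>
    hrem.reaches hν (h _ μ ⟨μ₀, hμ₀, (bestStep_remove hacc hμ₀ hw).step⟩ hμ)
  exact hnt fun μ μ' hμ hμ' => (hall μ hμ).eq (hall μ' hμ')

theorem AlmostStable.not_stable {l : Matching F W} (h : M.AlmostStable l) : ¬ M.Stable l := by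
  obtain ⟨_, -, f, w, hb, -⟩ := h
  exact fun hs => hs f w hb

theorem exists_almostStable_bestReaches [Fintype F] [Fintype W] {l : Matching F W}
    (h : ¬ M.Stable l) : ∃ m, M.AlmostStable m ∧ M.BestReaches l m := by
  obtain ⟨μ, hμ, hr⟩ := exists_stable_bestReaches (M := M) l
  rcases Relation.ReflTransGen.cases_tail hr with rfl | ⟨m, hm, hs⟩
  · exact absurd hμ h
  · exact ⟨m, ⟨μ, hμ, hs.step⟩, hm⟩

end Market

theorem theorem1 {F W : Type*} [Fintype F] [Fintype W] (M : Market F W)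
    (hacc : M.AllAcceptable) (hbal : Fintype.card F = Fintype.card W) :
    List.TFAE [
      ∀ l μ : Matching F W, ¬ M.Stable l → M.Stable μ → M.Reaches l μ,
      ∀ l μ : Matching F W, M.AlmostStable l → M.Stable μ → M.Reaches l μ,
      ∀ (A : Finset F) (B : Finset W), ¬ M.IsNontrivialFragment A B] ∧
    List.TFAE [
      ∀ l μ : Matching F W, ¬ M.Stable l → M.Stable μ → M.BestReaches l μ,
      ∀ l μ : Matching F W, M.AlmostStable l → M.Stable μ → M.BestReaches l μ,
      ∀ (A : Finset F) (B : Finset W), ¬ M.IsNontrivialFragment A B] := by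
  -- The implication for best blocking pairs is the stronger one and closes both cycles.
  have hbest : (∀ (A : Finset F) (B : Finset W), ¬ M.IsNontrivialFragment A B) →
      ∀ l μ : Matching F W, ¬ M.Stable l → M.Stable μ → M.BestReaches l μ := by
    intro hfrag l μ hl hμ
    obtain ⟨m, hm, hr⟩ := Market.exists_almostStable_bestReaches hl
    exact hr.trans (Market.bestReaches_of_almostStable hacc hbal hfrag hm hμ)
  constructor
  · tfae_have 1 → 2 := fun h l μ hl => h l μ hl.not_stable
    tfae_have 2 → 3 := Market.not_isNontrivialFragment hacc hbal
    tfae_have 3 → 1 := fun h l μ hl hμ => (hbest h l μ hl hμ).reaches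
    tfae_finish
  · tfae_have 1 → 2 := fun h l μ hl => h l μ hl.not_stable
    tfae_have 2 → 3 := fun h =>
      Market.not_isNontrivialFragment hacc hbal fun l μ hl hμ => (h l μ hl hμ).reaches
    tfae_have 3 → 1 := hbest
    tfae_finish
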